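/- Throughout, $L^m=\{z\in\mathbb R^m : z_m\ge (z_1^2+\dots+z_{m-1}^2)^{1/2}\}$ ($m\ge 1$) is the second-order cone; $z\ge_{L^m}0$ means $z\in L^m$ and $z>_{L^m}0$ means that the inequality is strict. A set $\mathscr W\subseteq\mathbb R^d$ is *second-order cone representable* if there are finitely many matrices $A_j$ and vectors $b_j$ such that $y\in\mathscr W\iff\exists v:\ A_j\binom{y}{v}-b_j\ge_{L^{m_j}}0$ for all $j$. A family $\mathscr W(\theta)$, with $\theta$ in a subset $D$ of some $\mathbb R^p$, is *differentiable parameterized second-order cone representable* if the same holds for every $\theta\in D$ with $A_j(\theta),b_j(\theta)$ whose number and sizes do not depend on $\theta$ and whose entries are differentiable in $\theta$ on $D$. **Ambiguity set.** Let $\varXi\subseteq\mathbb R^K$ be second-order cone representable, and for $i=1,\dots,I$ let $\mathcal A_i\subseteq\mathbb R^{p_i}$ and $g_i:\mathbb R^K\times\mathbb R^{p_i}\to\mathbb R$ be such that the epigraphs $\{(y,u): u\ge g_i(y,\alpha_i)\}$, $\alpha_i\in\mathcal A_i$, are differentiable parameterized second-order cone representable. For $\theta=(\alpha,\sigma)\in\Theta:=\prod_i\mathcal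 A_i\times\mathbb R^I$ let $\mathscr U(\theta)$ be the set of all Borel probability measures $\mathbb P$ on $\mathbb R^K$ with $\mathbb P(\varXi)=1$ such that each $g_i(\cdot,\alpha_i)$ is $\mathbb P$-integrable with $\mathbb E_{\mathbb P}[g_i(y,\alpha_i)]\le\sigma_i$. The set $$\mathscr V(\theta)=\{(y,u)\in\mathbb R^K\times\mathbb R^I:\ y\in\varXi,\ g_i(y,\alpha_i)\le u_i\ \forall i\}$$ is then differentiable parameterized second-order cone representable; fix such a representation, with data $A_j(\theta),b_j(\theta)$, $\theta\in\Theta$. *Slater's condition* holds at $\theta$ if there is $(y^*,u^*,v^*)$ with $u_i^*<\sigma_i$ for all $i$ and $A_j(\theta)(y^*,u^*,v^*)^T-b_j(\theta)>_{L^{m_j}}0$ for all $j$. **Cost.** Let $\mathcal X\subseteq\mathbb R^n$ be any set and suppose that one of the following holds. (i) (single stage) $c(x,y)=\sum_{k=1}^K c_k(x)y_k$, where each $c_k:\mathbb R^n\to\mathbb R$ has a second-order cone representable epigraph, and $y\ge 0$ for all $y\in\varXi$. (ii) (two stages, relatively complete recourse) There are $T_0,\dots,T_K$, $h_0,\dots,h_K$,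 $W$, $q$ such that for all $x\in\mathcal X$ and $y\in\varXi$ the linear program $$\min_{\gamma\ge0}\ q^T\gamma\quad\text{s.t.}\quad \Big(T_0+\sum_k y_kT_k\Big)x+W\gamma=h_0+\sum_k y_kh_k$$ is feasible and attains its minimum, which is $c(x,y)$. **Theorem.** There is a linear second-order cone program in a variable $w$, $$\min_w\ \hat q(\theta)^Tw\quad\text{s.t.}\quad \hat A_j(\theta)\binom{x}{w}-\hat b_j(\theta)\ge_{L^{\hat m_j}}0\ \ \forall j\in[\hat J],$$ with finitely many constraints, all affine in $(x,w)$, whose number and sizes do not depend on $(x,\theta)$ and whose data $\hat q,\hat A_j,\hat b_j$ do not depend on $x$ and are differentiable in $\theta$ on $\Theta$, such that for every $\theta\in\Theta$ at which Slater's condition holds and every $x\in\mathcal X$ the worst-case expectation $$f(x,\mathscr U(\theta))=\sup_{\mathbb P\in\mathscr U(\theta)}\mathbb E_{y\sim\mathbb P}[c(x,y)]\in(-\infty,+\infty]$$ equals the optimal value of this program ($+\infty$ if it is infeasible), and the minimum in the program is attained whenever $f(x,\mathscr U(\theta))<+\infty$. (Here $\mathbb E[c]=\mathbb E[c^+]-\mathbb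 E[c^-]$ as an extended real number; measures for which both parts are infinite do not enter the supremum.) -/

import Mathlib

open MeasureTheory

noncomputable section

/-- The second-order cone of dimension `m + 1`: the last coordinate dominates the Euclidean norm
of the first `m` coordinates. -/
def secondOrderCone (m : ℕ) : Set (Fin (m + 1) → ℝ) :=
  {z | Real.sqrt (∑ i : Fin m, z i.castSucc ^ 2) ≤ z (Fin.last m)}

/-- The interior of the second-order cone, `z >_L 0`. -/
def secondOrderConeStrict (m : ℕ) : Set (Fin (m + 1) → ℝ) :=
  {z | Real.sqrt (∑ i : Fin m, z i.castSucc ^ 2) < z (Fin.last m)}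

/-- A finite system of second-order cone inequalities `A_j(θ) [y; v] - b_j(θ) ≥ 0` in the
variables `y` (indexed by `ι`) and the auxiliary variables `v` (indexed by `N`), whose data depend
on a parameter `θ : P`. Number and dimensions of the inequalities and the number of auxiliary
variables do not depend on `θ`. -/
structure SOCSystem (P : Type) (ι : Type) where
  J : Type
  [fintypeJ : Fintype J]
  N : Type
  [fintypeN : Fintype N]
  m : J → ℕ
  A : P → (j : J) → Matrix (Fin (m j + 1)) (ι ⊕ N) ℝ
  b : P → (j : J) → Fin (m j + 1) → ℝ

attribute [instance] SOCSystem.fintypeJ SOCSystem.fintypeN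

namespace SOCSystem

variable {P ι : Type} [Fintype ι]

/-- `(y, v)` satisfies all the inequalities at the parameter `θ`. -/
def Holds (S : SOCSystem P ι) (θ : P) (y : ι → ℝ) (v : S.N → ℝ) : Prop :=
  ∀ j, (S.A θ j).mulVec (Sum.elim y v) - S.b θ j ∈ secondOrderCone (S.m j)

/-- `(y, v)` satisfies all the inequalities strictly at the parameter `θ`. -/
def HoldsStrictly (S : SOCSystem P ι) (θ : P) (y : ι → ℝ) (v : S.N → ℝ) : Prop :=
  ∀ j, (S.A θ j).mulVec (Sum.elim y v) - S.b θ j ∈ secondOrderConeStrict (S.m j)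

/-- All entries of the data are differentiable functions of the parameter on `D`. -/
def DataDifferentiableOn {P ι : Type} [NormedAddCommGroup P] [NormedSpace ℝ P]
    (S : SOCSystem P ι) (D : Set P) : Prop :=
  (∀ j r c, DifferentiableOn ℝ (fun θ => S.A θ j r c) D) ∧
  (∀ j r, DifferentiableOn ℝ (fun θ => S.b θ j r) D)

/-- `S` is a differentiable parameterized second-order cone representation of the family of sets
`W θ`, `θ ∈ D`. -/
def Represents [NormedAddCommGroup P] [NormedSpace ℝ P]
    (S : SOCSystem P ι) (D : Set P) (W : P → Set (ι → ℝ)) : Prop :=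
  S.DataDifferentiableOn D ∧ ∀ θ ∈ D, ∀ y, y ∈ W θ ↔ ∃ v, S.Holds θ y v

/-- The optimal value of the linear second-order cone program
`min_w q(θ)ᵀ w` subject to `A_j(θ) [x; w] - b_j(θ) ≥ 0` for all `j`
(`⊤` if it is infeasible, `⊥` if it is unbounded). -/
def programValue (S : SOCSystem P ι) (q : P → S.N → ℝ) (θ : P) (x : ι → ℝ) : EReal :=
  ⨅ (w : S.N → ℝ) (_ : S.Holds θ x w), ((q θ ⬝ᵥ w : ℝ) : EReal)

end SOCSystem

/-- Second-order cone representable sets (no parameter). -/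
def SOCRepresentable {ι : Type} [Fintype ι] (W : Set (ι → ℝ)) : Prop :=
  ∃ S : SOCSystem Unit ι, ∀ y, y ∈ W ↔ ∃ v, S.Holds () y v

/-- Differentiable parameterized second-order cone representable sets, for parameters in `D`. -/
def DiffParamSOCRepresentable {P ι : Type} [Fintype ι] [NormedAddCommGroup P] [NormedSpace ℝ P]
    (D : Set P) (W : P → Set (ι → ℝ)) : Prop :=
  ∃ S : SOCSystem P ι, S.Represents D W

/-- The epigraph of `f`, with the extra coordinate indexed by `Unit`. -/
def epigraph {ι : Type} (f : (ι → ℝ) → ℝ) : Set (ι ⊕ Unit → ℝ) :=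
  {z | f (fun k => z (Sum.inl k)) ≤ z (Sum.inr ())}

/-- The data of a parameterized SOC ambiguity set for an uncertainty in `ℝ^K` with `I` moment
constraints: a support `Ξ` and functions `g i (y, α i)`, with `α i` in a domain `𝒜 i ⊆ ℝ^(p i)`. -/
structure ParamSOCAmbiguity (K I : ℕ) where
  p : Fin I → ℕ
  dom : (i : Fin I) → Set (Fin (p i) → ℝ)
  supp : Set (Fin K → ℝ)
  g : (i : Fin I) → (Fin K → ℝ) → (Fin (p i) → ℝ) → ℝ
  supp_representable : SOCRepresentable supp
  epi_representable : ∀ i,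
    DiffParamSOCRepresentable (dom i) (fun α => epigraph (fun y => g i y α))

namespace ParamSOCAmbiguity

variable {K I : ℕ}

/-- The parameter `θ = (α, σ)`. -/
abbrev Param (U : ParamSOCAmbiguity K I) : Type :=
  ((i : Fin I) → Fin (U.p i) → ℝ) × (Fin I → ℝ)

/-- The admissible parameters: `α i ∈ 𝒜 i`; the bounds `σ` are unrestricted. -/
def paramDom (U : ParamSOCAmbiguity K I) : Set U.Param :=
  {θ | ∀ i, θ.1 i ∈ U.dom i}

/-- The ambiguity set `𝒰(θ)`: probability distributions concentrated on the support such that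
each `g i` has an expectation bounded by `σ i`. -/
def toSet (U : ParamSOCAmbiguity K I) (θ : U.Param) : Set (Measure (Fin K → ℝ)) :=
  {μ | IsProbabilityMeasure μ ∧ (∀ᵐ y ∂μ, y ∈ U.supp) ∧
    ∀ i, Integrable (fun y => U.g i y (θ.1 i)) μ ∧ ∫ y, U.g i y (θ.1 i) ∂μ ≤ θ.2 i}

/-- The lifted support `𝒱(θ) = {(y, u) | y ∈ Ξ, g i (y, α i) ≤ u i for all i}`. -/
def lifted (U : ParamSOCAmbiguity K I) (θ : U.Param) : Set (Fin K ⊕ Fin I → ℝ) :=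
  {z | (fun k => z (Sum.inl k)) ∈ U.supp ∧
    ∀ i, U.g i (fun k => z (Sum.inl k)) (θ.1 i) ≤ z (Sum.inr i)}

/-- Slater's condition at `θ`, for a representation `R` of the lifted support: some `(y, u, v)`
satisfies all the second-order cone inequalities of `R` strictly, and `u i < σ i` for all `i`. -/
def Slater (U : ParamSOCAmbiguity K I) (R : SOCSystem U.Param (Fin K ⊕ Fin I))
    (θ : U.Param) : Prop :=
  ∃ (y : Fin K → ℝ) (u : Fin I → ℝ) (v : R.N → ℝ),
    (∀ i, u i < θ.2 i) ∧ R.HoldsStrictly θ (Sum.elim y u) v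

/-- The lifted support always has a differentiable parameterized second-order cone representation,
obtained by stacking the representations of the support and of the epigraphs. -/
theorem exists_represents_lifted (U : ParamSOCAmbiguity K I) :
    ∃ R : SOCSystem U.Param (Fin K ⊕ Fin I), R.Represents U.paramDom U.lifted := by
  obtain ⟨S₀, h₀⟩ := U.supp_representable
  choose S hd hr using U.epi_representable
  let R : SOCSystem U.Param (Fin K ⊕ Fin I) :=
    { J := S₀.J ⊕ (Σ i, (S i).J)
      N := S₀.N ⊕ (Σ i, (S i).N)
      m := Sum.elim S₀.m (fun s => (S s.1).m s.2)
      A := fun θ j => match j with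
        | Sum.inl j => fun r c => match c with
          | Sum.inl (Sum.inl k) => S₀.A () j r (Sum.inl k)
          | Sum.inl (Sum.inr _) => 0
          | Sum.inr (Sum.inl a) => S₀.A () j r (Sum.inr a)
          | Sum.inr (Sum.inr _) => 0
        | Sum.inr ⟨i, j⟩ => fun r c => match c with
          | Sum.inl (Sum.inl k) => (S i).A (θ.1 i) j r (Sum.inl (Sum.inl k))
          | Sum.inl (Sum.inr i') =>
              if i' = i then (S i).A (θ.1 i) j r (Sum.inl (Sum.inr ())) else 0
          | Sum.inr (Sum.inl _) => 0
          | Sum.inr (Sum.inr ⟨i', a⟩) =>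
              if h : i' = i then (S i).A (θ.1 i) j r (Sum.inr (h ▸ a)) else 0
      b := fun θ j => match j with
        | Sum.inl j => S₀.b () j
        | Sum.inr ⟨i, j⟩ => (S i).b (θ.1 i) j }
  have hproj : ∀ i, DifferentiableOn ℝ (fun θ : U.Param => θ.1 i) U.paramDom := by
    intro i
    fun_prop
  have hmaps : ∀ i, Set.MapsTo (fun θ : U.Param => θ.1 i) U.paramDom (U.dom i) :=
    fun i θ hθ => hθ i
  have key : ∀ (θ : U.Param) (z : Fin K ⊕ Fin I → ℝ) (v : R.N → ℝ),
      R.Holds θ z v ↔ S₀.Holds () (fun k => z (Sum.inl k)) (fun a => v (Sum.inl a)) ∧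
        ∀ i, (S i).Holds (θ.1 i)
          (Sum.elim (fun k => z (Sum.inl k)) (fun _ => z (Sum.inr i)))
          (fun a => v (Sum.inr ⟨i, a⟩)) := by
    intro θ z v
    have e₀ : ∀ j, (R.A θ (Sum.inl j)).mulVec (Sum.elim z v) =
        (S₀.A () j).mulVec
          (Sum.elim (fun k => z (Sum.inl k)) (fun a => v (Sum.inl a))) := by
      intro j
      funext r
      simp only [Matrix.mulVec, dotProduct, Fintype.sum_sum_type, Sum.elim_inl, Sum.elim_inr]
      erw [Fintype.sum_sum_type]
      simp [R]
    have e₁ : ∀ i j, (R.A θ (Sum.inr ⟨i, j⟩)).mulVec (Sum.elim z v) =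
        ((S i).A (θ.1 i) j).mulVec
          (Sum.elim (Sum.elim (fun k => z (Sum.inl k)) (fun _ => z (Sum.inr i)))
            (fun a => v (Sum.inr ⟨i, a⟩))) := by
      intro i j
      funext r
      simp only [Matrix.mulVec, dotProduct, Fintype.sum_sum_type, Sum.elim_inl, Sum.elim_inr]
      erw [Fintype.sum_sum_type]
      simp only [R, zero_mul, Finset.sum_const_zero, zero_add]
      rw [Fintype.sum_sigma, Finset.sum_eq_single i]
      · simp
      · intro i' _ hi'
        simp [hi']
      · simp
    constructor
    · intro h
      refine ⟨fun j => ?_, fun i j => ?_⟩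
      · have := h (Sum.inl j)
        rw [e₀] at this
        exact this
      · have := h (Sum.inr ⟨i, j⟩)
        rw [e₁] at this
        exact this
    · rintro ⟨h, h'⟩ (j | ⟨i, j⟩)
      · rw [e₀]
        exact h j
      · rw [e₁]
        exact h' i j
  have hS : ∀ (θ : U.Param), θ ∈ U.paramDom → ∀ (z : Fin K ⊕ Fin I → ℝ) (i : Fin I),
      U.g i (fun k => z (Sum.inl k)) (θ.1 i) ≤ z (Sum.inr i) ↔
        ∃ v, (S i).Holds (θ.1 i)
          (Sum.elim (fun k => z (Sum.inl k)) (fun _ => z (Sum.inr i))) v := by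
    intro θ hθ z i
    rw [← hr i (θ.1 i) (hθ i)]
    simp [epigraph]
  refine ⟨R, ⟨?_, ?_⟩, ?_⟩
  · rintro (j | ⟨i, j⟩) r ((k | i') | (a | ⟨i', a⟩))
    · exact differentiableOn_const _
    · exact differentiableOn_const _
    · exact differentiableOn_const _
    · exact differentiableOn_const _
    · exact ((hd i).1 j r _).comp (hproj i) (hmaps i)
    · by_cases h : i' = i
      · subst h
        exact (((hd i').1 j r (Sum.inl (Sum.inr ()))).comp (hproj i') (hmaps i')).congr
          (fun θ _ => by simp [R])
      · simp [R, h]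
    · exact differentiableOn_const _
    · by_cases h : i' = i
      · subst h
        exact (((hd i').1 j r (Sum.inr a)).comp (hproj i') (hmaps i')).congr
          (fun θ _ => by simp [R])
      · simp [R, h]
  · rintro (j | ⟨i, j⟩) r
    · exact differentiableOn_const _
    · exact ((hd i).2 j r).comp (hproj i) (hmaps i)
  · intro θ hθ z
    constructor
    · rintro ⟨h, h'⟩
      obtain ⟨v₀, hv₀⟩ := (h₀ _).1 h
      choose v hv using fun i => (hS θ hθ z i).1 (h' i)
      exact ⟨Sum.elim v₀ (fun s => v s.1 s.2), (key θ z _).2 ⟨hv₀, hv⟩⟩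
    · rintro ⟨v, hv⟩
      obtain ⟨h, h'⟩ := (key θ z v).1 hv
      exact ⟨(h₀ _).2 ⟨_, h⟩, fun i => (hS θ hθ z i).2 ⟨_, h' i⟩⟩

end ParamSOCAmbiguity

/-- The extended expectation `E[φ⁺] - E[φ⁻]`; it is the usual expectation if `φ` is integrable, and
`⊥` (hence irrelevant for a supremum) if both parts have infinite expectation. -/
def extExpectation {Ω : Type} [MeasurableSpace Ω] (μ : Measure Ω) (φ : Ω → ℝ) : EReal :=
  ((∫⁻ y, ENNReal.ofReal (φ y) ∂μ : ENNReal) : EReal) -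
    ((∫⁻ y, ENNReal.ofReal (-φ y) ∂μ : ENNReal) : EReal)

/-- The worst-case expectation `f(x, 𝒰(θ)) = sup_{ℙ ∈ 𝒰(θ)} E_ℙ[c(x, y)]`. -/
def worstCaseExpectation {n K I : ℕ} (U : ParamSOCAmbiguity K I)
    (c : (Fin n → ℝ) → (Fin K → ℝ) → ℝ) (θ : U.Param) (x : Fin n → ℝ) : EReal :=
  ⨆ μ ∈ U.toSet θ, extExpectation μ (c x)

/-- Single-stage cost: `c(x, y) = ∑ k, c_k(x) y_k` where the epigraph of each `c_k` is second-order
cone representable and the uncertainty is nonnegative. -/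
def IsSingleStageCost {n K : ℕ} (supp : Set (Fin K → ℝ))
    (c : (Fin n → ℝ) → (Fin K → ℝ) → ℝ) : Prop :=
  (∃ ck : Fin K → (Fin n → ℝ) → ℝ,
    (∀ k, SOCRepresentable (epigraph (ck k))) ∧ ∀ x y, c x y = ∑ k, ck k x * y k) ∧
  ∀ y ∈ supp, ∀ k, 0 ≤ y k

/-- The feasible set `{γ ≥ 0 | (T₀ + ∑ k, y_k T_k) x + W γ = h₀ + ∑ k, y_k h_k}` of the recourse
problem. -/
def recourseFeasible {n K M G : ℕ} (T₀ : Matrix (Fin M) (Fin n) ℝ)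
    (T : Fin K → Matrix (Fin M) (Fin n) ℝ) (h₀ : Fin M → ℝ) (h : Fin K → Fin M → ℝ)
    (W : Matrix (Fin M) (Fin G) ℝ) (x : Fin n → ℝ) (y : Fin K → ℝ) : Set (Fin G → ℝ) :=
  {γ | (∀ l, 0 ≤ γ l) ∧
    (T₀ + ∑ k, y k • T k).mulVec x + W.mulVec γ = h₀ + ∑ k, y k • h k}

/-- Two-stage cost with relatively complete recourse: for all `x ∈ X` and all `y` in the support the
recourse problem is feasible, and `c(x, y)` is its minimum. -/
def IsTwoStageCost {n K : ℕ} (X : Set (Fin n → ℝ)) (supp : Set (Fin K → ℝ))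
    (c : (Fin n → ℝ) → (Fin K → ℝ) → ℝ) : Prop :=
  ∃ (M G : ℕ) (T₀ : Matrix (Fin M) (Fin n) ℝ) (T : Fin K → Matrix (Fin M) (Fin n) ℝ)
    (h₀ : Fin M → ℝ) (h : Fin K → Fin M → ℝ) (W : Matrix (Fin M) (Fin G) ℝ) (q : Fin G → ℝ),
    ∀ x ∈ X, ∀ y ∈ supp,
      (recourseFeasible T₀ T h₀ h W x y).Nonempty ∧
      IsLeast ((fun γ => q ⬝ᵥ γ) '' recourseFeasible T₀ T h₀ h W x y) (c x y)

end

/-! A finitely supported measure turns the worst-case expectation into a convex program over the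
convex hull of the points `(σ - g(y), F - c(x, y))`, and Slater's condition supplies Lagrange
multipliers: the worst case is at most `F` iff some affine combination `r + ∑ i, β i * g i y` with
`β ≥ 0` dominates `c(x, y)` on the support and `r + σ ⬝ᵥ β ≤ F`.

In both cost models this domination means that finitely many functions affine in `y` are dominated:
a single one in the single-stage case, and one for each of finitely many dual solutions of the
recourse problem (whose choice depends only on `W` and `q`) in the two-stage case. Since `β ≥ 0`,
such a domination is the nonnegativity of an affine function on the lifted support, which by conic
duality, again under Slater's condition, has a certificate in the self-dual second-order cones. The
certificates are subject to constraints that are jointly linear in all the unknowns and in `x`. -/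

section LagrangeMultipliers

theorem nonpos_and_nonneg_of_forall_pos_mul_le {𝕜 : Type*} [Field 𝕜] [LinearOrder 𝕜]
    [IsStrictOrderedRing 𝕜] {a s : 𝕜} (h : ∀ t, 0 < t → t * a ≤ s) : a ≤ 0 ∧ 0 ≤ s := by
  have ha : a ≤ 0 := by
    by_contra! ha
    have := h ((|s| + 1) / a) (by positivity)
    rw [div_mul_cancel₀ _ ha.ne'] at this
    linarith [le_abs_self s]
  refine ⟨ha, ?_⟩
  by_contra! hs
  have ha' : a < 0 := by linarith [h 1 one_pos]
  have := h (s / (2 * a)) (div_pos_of_neg_of_neg hs (by linarith))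
  rw [div_mul_eq_mul_div, mul_div_mul_right _ _ ha'.ne] at this
  linarith

theorem exists_lagrange_multiplier {E : Type*} [AddCommGroup E] [Module ℝ E] [TopologicalSpace E]
    [IsTopologicalAddGroup E] [ContinuousSMul ℝ E] {C : ConvexCone ℝ E}
    (hC : IsOpen (C : Set E)) {S : Set (E × ℝ)} (hS : Convex ℝ S) {p₀ : E × ℝ} (hp₀ : p₀ ∈ S)
    (slater : p₀.1 ∈ C) (h : ∀ p ∈ S, p.1 ∈ C → 0 ≤ p.2) :
    ∃ ℓ : E →L[ℝ] ℝ, (∀ z ∈ C, 0 ≤ ℓ z) ∧ ∀ p ∈ S, ℓ p.1 ≤ p.2 := by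
  have hdisj : Disjoint ((C : Set E) ×ˢ Set.Iio (0 : ℝ)) S :=
    Set.disjoint_left.2 fun p hp hpS => (h p hpS hp.1).not_gt hp.2
  obtain ⟨F, s, hFC, hFS⟩ := geometric_hahn_banach_open (C.convex.prod (convex_Iio _))
    (hC.prod isOpen_Iio) hS hdisj
  let L : E →L[ℝ] ℝ := F.comp (.inl ℝ E ℝ)
  let η : ℝ := F (0, 1)
  have hF (z : E) (τ : ℝ) : F (z, τ) = L z + τ * η := by
    rw [← smul_eq_mul, ← map_smul, ContinuousLinearMap.comp_apply, ← map_add]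
    simp
  have scale : ∀ z ∈ C, ∀ τ < 0, F (z, τ) ≤ 0 ∧ 0 ≤ s := fun z hz τ hτ =>
    nonpos_and_nonneg_of_forall_pos_mul_le fun t ht => by
      rw [← smul_eq_mul, ← map_smul, Prod.smul_mk]
      exact (hFC _ (Set.mk_mem_prod (C.smul_mem ht hz)
        (Set.mem_Iio.2 (mul_neg_of_pos_of_neg ht hτ)))).le
  have hs : 0 ≤ s := (scale _ slater (-1) (by norm_num)).2
  have hη_L : ∀ z ∈ C, -η ≤ 0 ∧ 0 ≤ -L z := fun z hz =>
    nonpos_and_nonneg_of_forall_pos_mul_le fun t ht => by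
      have := (scale z hz (-t) (by linarith)).1
      rw [hF] at this
      linarith
  have hη : 0 < η := by
    have hlt := hFC (p₀.1, -1) ⟨slater, by norm_num⟩
    have hle := hFS p₀ hp₀
    have hη₀ := (hη_L _ slater).1
    refine lt_of_le_of_ne (by linarith) fun hη₁ => ?_
    rw [hF, ← hη₁] at hlt hle
    linarith
  refine ⟨-(η⁻¹ • L), fun z hz => ?_, fun p hp => ?_⟩
  · simpa using mul_nonneg (inv_nonneg.2 hη.le) (hη_L z hz).2
  · have := hFS p hp
    rw [hF] at this
    have : -L p.1 ≤ p.2 * η := by linarith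
    simpa [div_eq_inv_mul] using (div_le_iff₀ hη).2 this

/-- The convex program is encoded by the set `S` of attainable pairs (constraint values, objective
value), with its optimal value normalized to be nonnegative. -/
theorem exists_lagrange_multipliers {J : Type*} [Fintype J] {E : J → Type*}
    [∀ j, AddCommGroup (E j)] [∀ j, Module ℝ (E j)] [∀ j, TopologicalSpace (E j)]
    [∀ j, IsTopologicalAddGroup (E j)] [∀ j, ContinuousSMul ℝ (E j)] {C : ∀ j, ConvexCone ℝ (E j)}
    (hC : ∀ j, IsOpen (C j : Set (E j))) {S : Set ((∀ j, E j) × ℝ)} (hS : Convex ℝ S)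
    {p₀ : (∀ j, E j) × ℝ} (hp₀ : p₀ ∈ S) (slater : ∀ j, p₀.1 j ∈ C j)
    (h : ∀ p ∈ S, (∀ j, p.1 j ∈ C j) → 0 ≤ p.2) :
    ∃ ℓ : ∀ j, E j →L[ℝ] ℝ, (∀ j, ∀ z ∈ C j, 0 ≤ ℓ j z) ∧ ∀ p ∈ S, ∑ j, ℓ j (p.1 j) ≤ p.2 := by
  classical
  let Cpi : ConvexCone ℝ (∀ j, E j) := ⨅ j, (C j).comap (LinearMap.proj j)
  have mem_Cpi {z : ∀ j, E j} : z ∈ Cpi ↔ ∀ j, z j ∈ C j := by simp [Cpi, ConvexCone.mem_iInf]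
  have hCpi : IsOpen (Cpi : Set (∀ j, E j)) := by
    simpa [Cpi, ConvexCone.coe_iInf] using
      isOpen_iInter_of_finite fun j => (hC j).preimage (continuous_apply j)
  obtain ⟨ℓ, hℓ, hℓS⟩ := exists_lagrange_multiplier hCpi hS hp₀ (mem_Cpi.2 slater)
    fun p hp hpC => h p hp (mem_Cpi.1 hpC)
  refine ⟨fun j => ℓ.comp (.single ℝ E j), fun j z hz => ?_, fun p hp => ?_⟩
  · refine (nonpos_and_nonneg_of_forall_pos_mul_le
      (a := -ℓ (Function.update p₀.1 j 0)) fun t ht => ?_).2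
    have hmem : Pi.single j z + t • Function.update p₀.1 j 0 ∈ Cpi := mem_Cpi.2 fun i => by
      rcases eq_or_ne i j with rfl | hij
      · simpa using hz
      · simpa [hij] using (C i).smul_mem ht (slater i)
    have := hℓ _ hmem
    rw [map_add, map_smul, smul_eq_mul] at this
    simp only [ContinuousLinearMap.comp_apply, ContinuousLinearMap.single_apply]
    linarith
  · refine le_of_eq_of_le ?_ (hℓS p hp)
    simp only [ContinuousLinearMap.comp_apply, ContinuousLinearMap.single_apply, ← map_sum,
      Finset.univ_sum_single]

end LagrangeMultipliers

section SecondOrderCone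

variable {m : ℕ}

theorem sqrt_sum_sq_castSucc_eq_norm (z : Fin (m + 1) → ℝ) :
    √(∑ i : Fin m, z i.castSucc ^ 2) = ‖WithLp.toLp 2 (Fin.init z)‖ := by
  simp [EuclideanSpace.norm_eq, Fin.init]

theorem secondOrderConeStrict_subset (m : ℕ) : secondOrderConeStrict m ⊆ secondOrderCone m :=
  fun _ h => le_of_lt (Set.mem_ofPred.1 h)

theorem isOpen_secondOrderConeStrict (m : ℕ) : IsOpen (secondOrderConeStrict m) :=
  isOpen_lt (by fun_prop) (by fun_prop)

/-- The interior of the second-order cone as a bundled convex cone, the form in which it enters the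
Lagrange multiplier theorem. -/
def secondOrderConvexCone (m : ℕ) : ConvexCone ℝ (Fin (m + 1) → ℝ) where
  carrier := secondOrderConeStrict m
  smul_mem' t ht z hz := by
    simp only [secondOrderConeStrict, sqrt_sum_sq_castSucc_eq_norm, Set.mem_ofPred_eq] at hz ⊢
    change ‖t • WithLp.toLp 2 (Fin.init z)‖ < t * z (Fin.last m)
    rw [norm_smul, Real.norm_of_nonneg ht.le]
    exact mul_lt_mul_of_pos_left hz ht
  add_mem' z hz w hw := by
    simp only [secondOrderConeStrict, sqrt_sum_sq_castSucc_eq_norm, Set.mem_ofPred_eq] at hz hw ⊢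
    exact (norm_add_le (WithLp.toLp 2 (Fin.init z)) (WithLp.toLp 2 (Fin.init w))).trans_lt
      (add_lt_add hz hw)

theorem mem_secondOrderCone_zero_iff (z : Fin (0 + 1) → ℝ) :
    z ∈ secondOrderCone 0 ↔ 0 ≤ z 0 := by
  simp [secondOrderCone]

theorem dotProduct_nonneg_of_mem_secondOrderCone {z w : Fin (m + 1) → ℝ}
    (hz : z ∈ secondOrderCone m) (hw : w ∈ secondOrderCone m) : 0 ≤ z ⬝ᵥ w := by
  simp only [secondOrderCone, Set.mem_ofPred_eq] at hz hw
  have cauchy_schwarz := Real.sum_mul_le_sqrt_mul_sqrt Finset.univ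
    (fun i : Fin m => -z i.castSucc) (fun i => w i.castSucc)
  simp only [neg_mul, Finset.sum_neg_distrib, neg_sq] at cauchy_schwarz
  have := mul_le_mul hz hw (Real.sqrt_nonneg _) ((Real.sqrt_nonneg _).trans hz)
  rw [dotProduct, Fin.sum_univ_castSucc]
  linarith

theorem mem_secondOrderCone_of_dotProduct_nonneg {z : Fin (m + 1) → ℝ}
    (h : ∀ w ∈ secondOrderConeStrict m, 0 ≤ z ⬝ᵥ w) : z ∈ secondOrderCone m := by
  set r := √(∑ i : Fin m, z i.castSucc ^ 2) with hr
  have hr₀ : 0 ≤ r := Real.sqrt_nonneg _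
  have hr_sq : ∑ i : Fin m, z i.castSucc * z i.castSucc = r * r := by
    simp only [← sq, hr, Real.sq_sqrt (Finset.sum_nonneg fun i _ => sq_nonneg (z (Fin.castSucc i)))]
  have reflected : ∀ ε > 0, 0 ≤ -(r * r) + z (Fin.last m) * (r + ε) := fun ε hε => by
    have := h (Fin.snoc (α := fun _ => ℝ) (fun i => -z i.castSucc) (r + ε)) (by
      simpa [secondOrderConeStrict, ← hr] using hε)
    simpa only [dotProduct, Fin.sum_univ_castSucc, Fin.snoc_castSucc, Fin.snoc_last, mul_neg,
      Finset.sum_neg_distrib, hr_sq] using this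
  obtain ⟨hlast, hlimit⟩ := nonpos_and_nonneg_of_forall_pos_mul_le
    (a := -z (Fin.last m)) (s := (z (Fin.last m) - r) * r) fun ε hε => by
      linarith [reflected ε hε]
  change r ≤ z (Fin.last m)
  rcases hr₀.eq_or_lt with hr_zero | hr_pos
  · linarith
  · exact sub_nonneg.1 (nonneg_of_mul_nonneg_left hlimit hr_pos)

end SecondOrderCone

theorem dotProduct_add_nonneg_iff {κ : Type*} [Fintype κ] {ψ : κ → ℝ} {s : ℝ} :
    (∀ z : κ → ℝ, 0 ≤ ψ ⬝ᵥ z + s) ↔ ψ = 0 ∧ 0 ≤ s := by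
  refine ⟨fun h => ?_, fun ⟨hψ, hs⟩ z => by simpa [hψ] using hs⟩
  obtain ⟨hψ, hs⟩ := nonpos_and_nonneg_of_forall_pos_mul_le (a := ψ ⬝ᵥ ψ) (s := s) fun t _ => by
    have := h (-(t • ψ))
    rw [dotProduct_neg, dotProduct_smul, smul_eq_mul] at this
    linarith
  have nonneg : 0 ≤ ψ ⬝ᵥ ψ := Finset.sum_nonneg fun i _ => mul_self_nonneg (ψ i)
  exact ⟨dotProduct_self_eq_zero.1 (hψ.antisymm nonneg), hs⟩

namespace SOCSystem

variable {P ι : Type}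

/-- A dual certificate for the nonnegativity of the affine function `z ↦ φ ⬝ᵥ z + c₀` on the
feasible set of `S` at `θ`: multipliers in the (self-dual) cones that aggregate the constraints
into this function, up to a nonnegative constant. -/
def IsDualCertificate (S : SOCSystem P ι) (θ : P) (lam : ∀ j, Fin (S.m j + 1) → ℝ)
    (φ : ι ⊕ S.N → ℝ) (c₀ : ℝ) : Prop :=
  (∀ j, lam j ∈ secondOrderCone (S.m j)) ∧
    ∑ j, Matrix.vecMul (lam j) (S.A θ j) = φ ∧ 0 ≤ ∑ j, lam j ⬝ᵥ S.b θ j + c₀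

variable [Fintype ι] {S : SOCSystem P ι} {θ : P} {φ : ι ⊕ S.N → ℝ} {c₀ : ℝ}

theorem sum_dotProduct_residual (S : SOCSystem P ι) (θ : P) (lam : ∀ j, Fin (S.m j + 1) → ℝ)
    (z : ι ⊕ S.N → ℝ) :
    ∑ j, lam j ⬝ᵥ ((S.A θ j).mulVec z - S.b θ j) =
      (∑ j, Matrix.vecMul (lam j) (S.A θ j)) ⬝ᵥ z - ∑ j, lam j ⬝ᵥ S.b θ j := by
  simp only [dotProduct_sub, Finset.sum_sub_distrib, sum_dotProduct, Matrix.dotProduct_mulVec]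

theorem IsDualCertificate.nonneg {lam : ∀ j, Fin (S.m j + 1) → ℝ}
    (h : S.IsDualCertificate θ lam φ c₀) {y : ι → ℝ} {v : S.N → ℝ} (hyv : S.Holds θ y v) :
    0 ≤ φ ⬝ᵥ Sum.elim y v + c₀ := by
  obtain ⟨hlam, rfl, hc₀⟩ := h
  have := Finset.sum_nonneg fun j (_ : j ∈ Finset.univ) =>
    dotProduct_nonneg_of_mem_secondOrderCone (hlam j) (hyv j)
  rw [sum_dotProduct_residual] at this
  linarith

theorem exists_isDualCertificate {y₀ : ι → ℝ} {v₀ : S.N → ℝ} (slater : S.HoldsStrictly θ y₀ v₀)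
    (h : ∀ y v, S.Holds θ y v → 0 ≤ φ ⬝ᵥ Sum.elim y v + c₀) :
    ∃ lam, S.IsDualCertificate θ lam φ c₀ := by
  let graph (z : ι ⊕ S.N → ℝ) : (∀ j, Fin (S.m j + 1) → ℝ) × ℝ :=
    (fun j => (S.A θ j).mulVec z - S.b θ j, φ ⬝ᵥ z + c₀)
  have convex_graph : Convex ℝ (Set.range graph) := by
    rintro _ ⟨z, rfl⟩ _ ⟨w, rfl⟩ s t - - hst
    refine ⟨s • z + t • w, Prod.ext (funext fun j => ?_) ?_⟩
    · simp only [graph, Matrix.mulVec_add, Matrix.mulVec_smul, Prod.fst_add, Prod.smul_fst,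
        Pi.add_apply, Pi.smul_apply, smul_sub]
      conv_lhs => rw [← one_smul ℝ (S.b θ j), ← hst, add_smul]
      abel
    · simp only [graph, dotProduct_add, dotProduct_smul, Prod.snd_add, Prod.smul_snd, smul_eq_mul]
      linear_combination -c₀ * hst
  obtain ⟨ℓ, hℓ, hgraph⟩ := exists_lagrange_multipliers
    (C := fun j => secondOrderConvexCone (S.m j)) (fun j => isOpen_secondOrderConeStrict _)
    convex_graph ⟨Sum.elim y₀ v₀, rfl⟩ slater (by
      rintro _ ⟨z, rfl⟩ hz
      rw [← Sum.elim_comp_inl_inr z] at hz ⊢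
      exact h _ _ fun j => secondOrderConeStrict_subset _ (hz j))
  choose lam hlam using fun j => (dotProductEquiv ℝ (Fin (S.m j + 1))).surjective (ℓ j).toLinearMap
  have ℓ_eq (j z) : ℓ j z = lam j ⬝ᵥ z := (LinearMap.congr_fun (hlam j) z).symm
  have residual := dotProduct_add_nonneg_iff.1 fun z => by
    have := hgraph _ ⟨z, rfl⟩
    simp only [ℓ_eq, graph, sum_dotProduct_residual] at this
    change 0 ≤ (φ - ∑ j, Matrix.vecMul (lam j) (S.A θ j)) ⬝ᵥ z + (∑ j, lam j ⬝ᵥ S.b θ j + c₀)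
    rw [sub_dotProduct]
    linarith
  exact ⟨lam, fun j => mem_secondOrderCone_of_dotProduct_nonneg fun w hw =>
    (hℓ j w hw).trans_eq (ℓ_eq j w), (sub_eq_zero.1 residual.1).symm, residual.2⟩

theorem Represents.forall_mem_nonneg_iff [NormedAddCommGroup P] [NormedSpace ℝ P] {D : Set P}
    {W : P → Set (ι → ℝ)} (hS : S.Represents D W) (hθ : θ ∈ D) {y₀ : ι → ℝ} {v₀ : S.N → ℝ}
    (slater : S.HoldsStrictly θ y₀ v₀) {ψ : ι → ℝ} :
    (∀ y ∈ W θ, 0 ≤ ψ ⬝ᵥ y + c₀) ↔ ∃ lam, S.IsDualCertificate θ lam (Sum.elim ψ 0) c₀ := by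
  have dot_elim (y : ι → ℝ) (v : S.N → ℝ) : Sum.elim ψ 0 ⬝ᵥ Sum.elim y v = ψ ⬝ᵥ y := by
    simp
  constructor
  · intro h
    refine exists_isDualCertificate slater fun y v hyv => ?_
    rw [dot_elim]
    exact h y ((hS.2 θ hθ y).2 ⟨v, hyv⟩)
  · rintro ⟨lam, hlam⟩ y hy
    obtain ⟨v, hyv⟩ := (hS.2 θ hθ y).1 hy
    simpa only [dot_elim] using hlam.nonneg hyv

end SOCSystem

section ExtExpectation

variable {Ω : Type} [MeasurableSpace Ω] {μ : Measure Ω} {φ ψ : Ω → ℝ}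

theorem extExpectation_eq_integral (h : Integrable φ μ) :
    extExpectation μ φ = ((∫ y, φ y ∂μ : ℝ) : EReal) := by
  have hneg : ∫⁻ y, ENNReal.ofReal (-φ y) ∂μ ≠ ⊤ := h.neg.lintegral_lt_top.ne
  rw [extExpectation, integral_eq_lintegral_pos_part_sub_lintegral_neg_part h, EReal.coe_sub,
    EReal.coe_ennreal_toReal h.lintegral_lt_top.ne, EReal.coe_ennreal_toReal hneg]

theorem extExpectation_mono (h : ∀ᵐ y ∂μ, φ y ≤ ψ y) : extExpectation μ φ ≤ extExpectation μ ψ :=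
  EReal.sub_le_sub
    (EReal.coe_ennreal_le_coe_ennreal_iff.2
      (lintegral_mono_ae (h.mono fun _ hy => ENNReal.ofReal_le_ofReal hy)))
    (EReal.coe_ennreal_le_coe_ennreal_iff.2
      (lintegral_mono_ae (h.mono fun _ hy => ENNReal.ofReal_le_ofReal (neg_le_neg hy))))

end ExtExpectation

/-- The finitely supported measure with mass `p a` at the point `y a`; integrating against it gives
the convex combinations in the moment duality. -/
noncomputable def diracMixture {Ω A : Type*} [MeasurableSpace Ω] [Fintype A] (p : A → ℝ)
    (y : A → Ω) : Measure Ω :=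
  ∑ a, ENNReal.ofReal (p a) • Measure.dirac (y a)

section DiracMixture

variable {Ω A : Type*} [MeasurableSpace Ω] [Fintype A] {p : A → ℝ} {y : A → Ω}

theorem isProbabilityMeasure_diracMixture (hp : ∀ a, 0 ≤ p a) (hp₁ : ∑ a, p a = 1) :
    IsProbabilityMeasure (diracMixture p y) := by
  constructor
  simp only [diracMixture, Measure.coe_finsetSum, Finset.sum_apply, Measure.smul_apply,
    measure_univ, smul_eq_mul, mul_one]
  rw [← ENNReal.ofReal_sum_of_nonneg fun a _ => hp a, hp₁, ENNReal.ofReal_one]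

variable [MeasurableSingletonClass Ω]

theorem ae_diracMixture {Q : Ω → Prop} (h : ∀ a, Q (y a)) : ∀ᵐ z ∂(diracMixture p y), Q z := by
  rw [diracMixture, ae_iff, Measure.coe_finsetSum, Finset.sum_apply]
  refine Finset.sum_eq_zero fun a _ => ?_
  rw [Measure.smul_apply, Measure.dirac_apply]
  simp [h a]

theorem integrable_diracMixture (φ : Ω → ℝ) : Integrable φ (diracMixture p y) := by
  rw [diracMixture, integrable_finsetSum_measure]
  exact fun a _ => (integrable_dirac (by simp)).smul_measure ENNReal.ofReal_ne_top

theorem integral_diracMixture (hp : ∀ a, 0 ≤ p a) (φ : Ω → ℝ) :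
    ∫ z, φ z ∂(diracMixture p y) = ∑ a, p a * φ (y a) := by
  rw [diracMixture, integral_finsetSum_measure fun a _ =>
    (integrable_dirac (by simp)).smul_measure ENNReal.ofReal_ne_top]
  simp only [integral_smul_measure, integral_dirac, ENNReal.toReal_ofReal (hp _), smul_eq_mul]

end DiracMixture

theorem ereal_eq_iInf_and_exists_eq {T : Sort*} {f : EReal} (hf : f ≠ ⊥) {p : T → Prop}
    {v : T → ℝ} (h : ∀ F : ℝ, f ≤ F ↔ ∃ w, p w ∧ v w ≤ F) :
    f = ⨅ (w) (_ : p w), (v w : EReal) ∧ (f ≠ ⊤ → ∃ w, p w ∧ (v w : EReal) = f) := by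
  have le_value (w) (hw : p w) : f ≤ v w := (h _).2 ⟨w, hw, le_rfl⟩
  have attained (hf' : f ≠ ⊤) : ∃ w, p w ∧ (v w : EReal) = f := by
    lift f to ℝ using ⟨hf', hf⟩
    obtain ⟨w, hw, hle⟩ := (h f).1 le_rfl
    exact ⟨w, hw, (EReal.coe_le_coe_iff.2 hle).antisymm (le_value w hw)⟩
  refine ⟨(le_iInf₂ le_value).antisymm ?_, attained⟩
  by_cases hf' : f = ⊤
  · exact hf' ▸ le_top
  · obtain ⟨w, hw, hfw⟩ := attained hf'
    exact (iInf₂_le w hw).trans_eq hfw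

namespace ParamSOCAmbiguity

variable {n K I : ℕ} {U : ParamSOCAmbiguity K I} {c : (Fin n → ℝ) → (Fin K → ℝ) → ℝ}
  {θ : U.Param} {x : Fin n → ℝ}

theorem diracMixture_mem_toSet {A : Type*} [Fintype A] {p : A → ℝ} (hp : ∀ a, 0 ≤ p a)
    (hp₁ : ∑ a, p a = 1) {y : A → Fin K → ℝ} (hy : ∀ a, y a ∈ U.supp)
    (hg : ∀ i, ∑ a, p a * U.g i (y a) (θ.1 i) ≤ θ.2 i) : diracMixture p y ∈ U.toSet θ :=
  ⟨isProbabilityMeasure_diracMixture hp hp₁, ae_diracMixture hy, fun i =>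
    ⟨integrable_diracMixture _, (integral_diracMixture hp _).trans_le (hg i)⟩⟩

theorem coe_sum_mul_le_worstCaseExpectation {A : Type*} [Fintype A] {p : A → ℝ}
    (hp : ∀ a, 0 ≤ p a) (hp₁ : ∑ a, p a = 1) {y : A → Fin K → ℝ} (hy : ∀ a, y a ∈ U.supp)
    (hg : ∀ i, ∑ a, p a * U.g i (y a) (θ.1 i) ≤ θ.2 i) :
    ((∑ a, p a * c x (y a) : ℝ) : EReal) ≤ worstCaseExpectation U c θ x := by
  rw [← integral_diracMixture hp, ← extExpectation_eq_integral (integrable_diracMixture _)]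
  exact le_iSup₂ (f := fun μ _ => extExpectation μ (c x)) _ (diracMixture_mem_toSet hp hp₁ hy hg)

theorem coe_le_worstCaseExpectation {y : Fin K → ℝ} (hy : y ∈ U.supp)
    (hg : ∀ i, U.g i y (θ.1 i) ≤ θ.2 i) : (c x y : EReal) ≤ worstCaseExpectation U c θ x := by
  simpa using coe_sum_mul_le_worstCaseExpectation (c := c) (x := x) (p := fun _ : Unit => 1)
    (fun _ => zero_le_one) (by simp) (fun _ => hy) (by simpa using hg)

theorem worstCaseExpectation_le_of_majorant {r : ℝ} {β : Fin I → ℝ} (hβ : ∀ i, 0 ≤ β i)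
    (h : ∀ y ∈ U.supp, c x y ≤ r + ∑ i, β i * U.g i y (θ.1 i)) :
    worstCaseExpectation U c θ x ≤ ((r + ∑ i, β i * θ.2 i : ℝ) : EReal) := by
  refine iSup₂_le fun μ ⟨hprob, hsupp, hg⟩ => ?_
  have hint : Integrable (fun y => ∑ i, β i * U.g i y (θ.1 i)) μ :=
    integrable_finsetSum _ fun i _ => (hg i).1.const_mul _
  have hint' : Integrable (fun y => r + ∑ i, β i * U.g i y (θ.1 i)) μ :=
    (integrable_const r).add hint
  refine (extExpectation_mono (hsupp.mono h)).trans ?_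
  rw [extExpectation_eq_integral hint', EReal.coe_le_coe_iff,
    integral_add (integrable_const r) hint, integral_finsetSum _ fun i _ => (hg i).1.const_mul _]
  simp only [integral_const, probReal_univ, smul_eq_mul, one_mul, integral_const_mul]
  gcongr with i
  exacts [hβ i, (hg i).2]

theorem exists_majorant {y₀ : Fin K → ℝ} (hy₀ : y₀ ∈ U.supp)
    (slater : ∀ i, U.g i y₀ (θ.1 i) < θ.2 i) {F : ℝ}
    (hF : worstCaseExpectation U c θ x ≤ (F : EReal)) :
    ∃ (r : ℝ) (β : Fin I → ℝ), (∀ i, 0 ≤ β i) ∧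
      (∀ y ∈ U.supp, c x y ≤ r + ∑ i, β i * U.g i y (θ.1 i)) ∧ r + ∑ i, β i * θ.2 i ≤ F := by
  let gap (y : Fin K → ℝ) : (Fin I → ℝ) × ℝ := (fun i => θ.2 i - U.g i y (θ.1 i), F - c x y)
  obtain ⟨ℓ, hℓ, hgap⟩ := exists_lagrange_multipliers (E := fun _ : Fin I => ℝ)
    (C := fun _ => ConvexCone.strictlyPositive ℝ ℝ) (fun _ => isOpen_Ioi)
    (convex_convexHull ℝ (gap '' U.supp)) (subset_convexHull ℝ _ ⟨y₀, hy₀, rfl⟩)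
    (fun i => sub_pos.2 (slater i)) (fun q hq hpos => by
      obtain ⟨A, _, p, w, hp, hp₁, hw, rfl⟩ := mem_convexHull_iff_exists_fintype.1 hq
      choose y hy hyw using hw
      have moments (i : Fin I) : ∑ a, p a * U.g i (y a) (θ.1 i) ≤ θ.2 i := by
        have := (ConvexCone.mem_strictlyPositive ..).1 (hpos i)
        simp only [← hyw, gap, Prod.fst_sum, Prod.smul_fst, Finset.sum_apply, Pi.smul_apply,
          smul_eq_mul, mul_sub, Finset.sum_sub_distrib, ← Finset.sum_mul, hp₁, one_mul] at this
        linarith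
      have := (coe_sum_mul_le_worstCaseExpectation hp hp₁ hy moments).trans hF
      simpa only [← hyw, gap, Prod.snd_sum, Prod.smul_snd, smul_eq_mul, mul_sub,
        Finset.sum_sub_distrib, ← Finset.sum_mul, hp₁, one_mul, sub_nonneg, EReal.coe_le_coe_iff]
        using this)
  obtain ⟨β, ℓ_eq⟩ : ∃ β : Fin I → ℝ, ∀ i t, ℓ i t = β i * t := ⟨fun i => ℓ i 1, fun i t => by
    rw [mul_comm, ← smul_eq_mul, ← map_smul, smul_eq_mul, mul_one]⟩
  refine ⟨F - ∑ i, β i * θ.2 i, β, fun i => ?_, fun y hy => ?_, by simp⟩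
  · simpa [ℓ_eq] using hℓ i 1
  · have := hgap _ (subset_convexHull ℝ _ ⟨y, hy, rfl⟩)
    simp only [gap, ℓ_eq, mul_sub, Finset.sum_sub_distrib] at this
    linarith

theorem worstCaseExpectation_le_coe_iff {y₀ : Fin K → ℝ} (hy₀ : y₀ ∈ U.supp)
    (slater : ∀ i, U.g i y₀ (θ.1 i) < θ.2 i) (F : ℝ) :
    worstCaseExpectation U c θ x ≤ (F : EReal) ↔ ∃ (r : ℝ) (β : Fin I → ℝ), (∀ i, 0 ≤ β i) ∧
      (∀ y ∈ U.supp, c x y ≤ r + ∑ i, β i * U.g i y (θ.1 i)) ∧ r + ∑ i, β i * θ.2 i ≤ F := by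
  refine ⟨exists_majorant hy₀ slater, fun ⟨r, β, hβ, hmaj, hle⟩ => ?_⟩
  exact (worstCaseExpectation_le_of_majorant hβ hmaj).trans (EReal.coe_le_coe_iff.2 hle)

end ParamSOCAmbiguity

section Farkas

variable {𝕜 V ι : Type*} [Field 𝕜] [LinearOrder 𝕜] [IsStrictOrderedRing 𝕜] [AddCommGroup V]
  [Module 𝕜 V] {s : Finset ι} {a : ι → V →ₗ[𝕜] 𝕜} {q : V →ₗ[𝕜] 𝕜}

theorem exists_pivot [DecidableEq ι] {k : ι}
    (h : ∀ v, (∀ i ∈ insert k s, 0 ≤ a i v) → 0 ≤ q v)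
    (hs : ¬∀ v, (∀ i ∈ s, 0 ≤ a i v) → 0 ≤ q v) :
    ∃ v, (∀ i ∈ s, 0 ≤ a i v) ∧ a k v = -1 ∧ q v < 0 := by
  push Not at hs
  obtain ⟨v, hv, hqv⟩ := hs
  have hkv : a k v < 0 := by
    by_contra! hkv
    exact (h v (Finset.forall_mem_insert _ _ _ |>.2 ⟨hkv, hv⟩)).not_gt hqv
  have ht : 0 < -(a k v)⁻¹ := by simpa using hkv
  refine ⟨-(a k v)⁻¹ • v, fun i hi => ?_, ?_, ?_⟩
  · simpa only [map_smul, smul_eq_mul] using mul_nonneg ht.le (hv i hi)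
  · rw [map_smul, smul_eq_mul, neg_mul, inv_mul_cancel₀ hkv.ne]
  · simpa only [map_smul, smul_eq_mul] using mul_neg_of_pos_of_neg ht hqv

theorem exists_nonneg_sum_smul_eq (s : Finset ι) (a : ι → V →ₗ[𝕜] 𝕜) (q : V →ₗ[𝕜] 𝕜)
    (h : ∀ v, (∀ i ∈ s, 0 ≤ a i v) → 0 ≤ q v) :
    ∃ c : ι → 𝕜, (∀ i, 0 ≤ c i) ∧ q = ∑ i ∈ s, c i • a i := by
  classical
  induction s using Finset.induction_on generalizing a q with
  | empty =>
    refine ⟨0, fun _ => le_rfl, LinearMap.ext fun v => ?_⟩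
    have h₁ := h v (by simp)
    have h₂ := h (-v) (by simp)
    rw [map_neg] at h₂
    simpa using le_antisymm (by linarith) h₁
  | insert k s hk ih =>
    suffices ∃ d : 𝕜, 0 ≤ d ∧ ∃ c : ι → 𝕜, (∀ i, 0 ≤ c i) ∧ q = d • a k + ∑ i ∈ s, c i • a i by
      obtain ⟨d, hd, c, hc, rfl⟩ := this
      refine ⟨Function.update c k d, fun i => ?_, ?_⟩
      · rcases eq_or_ne i k with rfl | hi
        · simpa using hd
        · simpa [hi] using hc i
      · rw [Finset.sum_insert hk, Function.update_self]
        refine congrArg _ (Finset.sum_congr rfl fun i hi => ?_)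
        rw [Function.update_of_ne (ne_of_mem_of_not_mem hi hk)]
    by_cases hs : ∀ v, (∀ i ∈ s, 0 ≤ a i v) → 0 ≤ q v
    · obtain ⟨c, hc, hq⟩ := ih a q hs
      exact ⟨0, le_rfl, c, hc, by rwa [zero_smul, zero_add]⟩
    -- Projecting along the pivot `v` onto the kernel of `a k` eliminates the constraint `a k`.
    obtain ⟨v, hv, hkv, hqv⟩ := exists_pivot h hs
    obtain ⟨c, hc, hq⟩ := ih (fun i => a i + a i v • a k) (q + q v • a k) fun w hw => by
      simpa [mul_comm] using h (w + a k w • v) fun i hi => by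
        rcases Finset.mem_insert.1 hi with rfl | hi
        · simp [hkv]
        · simpa [mul_comm] using hw i hi
    refine ⟨∑ i ∈ s, c i * a i v - q v, ?_, c, hc, ?_⟩
    · linarith [Finset.sum_nonneg fun i hi => mul_nonneg (hc i) (hv i hi)]
    · refine (eq_sub_of_add_eq hq).trans ?_
      simp only [smul_add, Finset.sum_add_distrib, smul_smul, ← Finset.sum_smul]
      module

end Farkas

section LinearProgram

variable {M G : Type*} [Fintype G] {W : Matrix M G ℝ} {q γ : G → ℝ} {b : M → ℝ}

/-- The feasible set of a linear program in standard form. -/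
def standardFeasible (W : Matrix M G ℝ) (b : M → ℝ) : Set (G → ℝ) :=
  {γ | 0 ≤ γ ∧ W.mulVec γ = b}

theorem dotProduct_nonneg_of_feasible_direction (hγ : γ ∈ standardFeasible W b)
    (hmin : IsMinOn (q ⬝ᵥ ·) (standardFeasible W b) γ) {d : G → ℝ} (hWd : W.mulVec d = 0)
    (hd : ∀ l, γ l = 0 → 0 ≤ d l) : 0 ≤ q ⬝ᵥ d := by
  have nonneg_eventually : ∀ᶠ ε : ℝ in nhdsWithin 0 (Set.Ioi 0), ∀ l, 0 ≤ γ l + ε * d l := by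
    refine Filter.eventually_all.2 fun l => ?_
    rcases (hγ.1 l).eq_or_lt with hl | hl
    · filter_upwards [self_mem_nhdsWithin] with ε hε
      exact add_nonneg hl.le (mul_nonneg (le_of_lt hε) (hd l hl.symm))
    · have htendsto : Filter.Tendsto (fun ε : ℝ => γ l + ε * d l) (nhds 0) (nhds (γ l)) :=
        Continuous.tendsto' (f := fun ε : ℝ => γ l + ε * d l) (by fun_prop) 0 (γ l) (by simp)
      filter_upwards [nhdsWithin_le_nhds (htendsto.eventually_const_lt hl)] with ε hε
      exact le_of_lt hε
  obtain ⟨ε, hε, hε₀⟩ := (nonneg_eventually.and self_mem_nhdsWithin).exists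
  have hle : q ⬝ᵥ γ ≤ q ⬝ᵥ (γ + ε • d) :=
    hmin ⟨hε, by rw [Matrix.mulVec_add, Matrix.mulVec_smul, hWd, smul_zero, add_zero, hγ.2]⟩
  rw [dotProduct_add, dotProduct_smul, smul_eq_mul] at hle
  exact nonneg_of_mul_nonneg_right (by linarith) (Set.mem_Ioi.1 hε₀)

variable [Fintype M]

theorem exists_complementary_dual (hγ : γ ∈ standardFeasible W b)
    (hmin : IsMinOn (q ⬝ᵥ ·) (standardFeasible W b) γ) :
    ∃ π : M → ℝ, Matrix.vecMul π W ≤ q ∧ ∀ l, γ l ≠ 0 → Matrix.vecMul π W l = q l := by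
  classical
  let ker := LinearMap.ker W.mulVecLin
  obtain ⟨c, hc, hq⟩ := exists_nonneg_sum_smul_eq (Finset.univ.filter fun l => γ l = 0)
    (fun l => (LinearMap.proj l).comp ker.subtype) ((dotProductEquiv ℝ G q).comp ker.subtype)
    fun d hd => dotProduct_nonneg_of_feasible_direction hγ hmin d.2 fun l hl =>
      hd l (Finset.mem_filter.2 ⟨Finset.mem_univ l, hl⟩)
  have mem_rowSpace : dotProductEquiv ℝ G q - ∑ l with γ l = 0, c l • LinearMap.proj l ∈
      LinearMap.range W.mulVecLin.dualMap := by
    rw [LinearMap.range_dualMap_eq_dualAnnihilator_ker, Submodule.mem_dualAnnihilator]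
    intro d hd
    simpa [sub_eq_zero] using LinearMap.congr_fun hq ⟨d, hd⟩
  obtain ⟨f, hf⟩ := mem_rowSpace
  obtain ⟨π, rfl⟩ := (dotProductEquiv ℝ M).surjective f
  have vecMul_eq (l : G) : Matrix.vecMul π W l = q l - if γ l = 0 then c l else 0 := by
    change π ⬝ᵥ W.col l = _
    simpa [Pi.single_apply] using LinearMap.congr_fun hf (Pi.single l 1)
  refine ⟨π, fun l => ?_, fun l hl => by simp [vecMul_eq, hl]⟩
  rw [vecMul_eq, sub_le_self_iff]
  split_ifs
  exacts [hc l, le_rfl]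

theorem exists_finset_isGreatest_dual (W : Matrix M G ℝ) (q : G → ℝ) :
    ∃ s : Finset (M → ℝ), ∀ b v, IsLeast ((q ⬝ᵥ ·) '' standardFeasible W b) v →
      IsGreatest ((· ⬝ᵥ b) '' (s : Set (M → ℝ))) v := by
  classical
  let Support := {B : Finset G //
    ∃ π : M → ℝ, Matrix.vecMul π W ≤ q ∧ ∀ l ∈ B, Matrix.vecMul π W l = q l}
  choose π hπ hπ_eq using fun B : Support => B.2
  refine ⟨Finset.univ.image π, ?_⟩
  rintro b _ ⟨⟨γ, hγ, rfl⟩, hmin⟩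
  have dual_value (ρ : M → ℝ) : ρ ⬝ᵥ b = Matrix.vecMul ρ W ⬝ᵥ γ := by
    rw [← hγ.2, Matrix.dotProduct_mulVec]
  constructor
  · obtain ⟨ρ, hρ, hρ_eq⟩ := exists_complementary_dual hγ
      (fun γ' hγ' => hmin (Set.mem_image_of_mem _ hγ'))
    let B : Support := ⟨Finset.univ.filter fun l => γ l ≠ 0, ρ, hρ, fun l hl =>
      hρ_eq l (Finset.mem_filter.1 hl).2⟩
    refine ⟨π B, by simp, ?_⟩
    change π B ⬝ᵥ b = q ⬝ᵥ γ
    rw [dual_value]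
    refine Finset.sum_congr rfl fun l _ => ?_
    by_cases hl : γ l = 0
    · simp [hl]
    · rw [hπ_eq B l (Finset.mem_filter.2 ⟨Finset.mem_univ l, hl⟩)]
  · rintro _ ⟨ρ, hρ, rfl⟩
    obtain ⟨B, -, rfl⟩ := Finset.mem_image.1 hρ
    simpa only [dual_value] using dotProduct_le_dotProduct_of_nonneg_right (hπ B) hγ.1

end LinearProgram

/-- A family of sets `W θ`, `θ ∈ D`, cut out by finitely many second-order cone constraints on
affine maps, without auxiliary variables. The ambient space is any real vector space, so that
variables need not be flattened into coordinates; differentiability of the data in `θ` is imposed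
pointwise, which for affine maps amounts to differentiability of the coefficients. -/
def SOCDefinableOn {P V : Type*} [NormedAddCommGroup P] [NormedSpace ℝ P] [AddCommGroup V]
    [Module ℝ V] (D : Set P) (W : P → Set V) : Prop :=
  ∃ (J : Type) (_ : Fintype J) (m : J → ℕ) (Φ : P → (j : J) → V →ᵃ[ℝ] (Fin (m j + 1) → ℝ)),
    (∀ j z, DifferentiableOn ℝ (fun θ => Φ θ j z) D) ∧
      ∀ θ ∈ D, ∀ z, z ∈ W θ ↔ ∀ j, Φ θ j z ∈ secondOrderCone (m j)

namespace SOCDefinableOn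

variable {P V V' : Type*} [NormedAddCommGroup P] [NormedSpace ℝ P] [AddCommGroup V] [Module ℝ V]
  [AddCommGroup V'] [Module ℝ V'] {D : Set P}

theorem secondOrderCone_preimage {m : ℕ} {f : P → V →ᵃ[ℝ] (Fin (m + 1) → ℝ)}
    (hf : ∀ z, DifferentiableOn ℝ (fun θ => f θ z) D) :
    SOCDefinableOn D fun θ => f θ ⁻¹' secondOrderCone m :=
  ⟨Unit, inferInstance, fun _ => m, fun θ _ => f θ, fun _ => hf, fun _ _ _ =>
    ⟨fun h _ => h, fun h => h ()⟩⟩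

theorem setOf_nonneg {f : P → V →ᵃ[ℝ] ℝ} (hf : ∀ z, DifferentiableOn ℝ (fun θ => f θ z) D) :
    SOCDefinableOn D fun θ => {z | 0 ≤ f θ z} := by
  convert secondOrderCone_preimage (m := 0) (f := fun θ => AffineMap.pi fun _ => f θ)
    fun z => differentiableOn_pi.2 fun _ => hf z using 2
  ext z
  exact (mem_secondOrderCone_zero_iff (AffineMap.pi (fun _ => f _) z)).symm

theorem iInter {L : Type} [Finite L] {W : L → P → Set V} (hW : ∀ l, SOCDefinableOn D (W l)) :
    SOCDefinableOn D fun θ => ⋂ l, W l θ := by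
  have := Fintype.ofFinite L
  choose J _ m Φ hΦ hmem using hW
  refine ⟨Σ l, J l, inferInstance, fun j => m j.1 j.2, fun θ j => Φ j.1 θ j.2,
    fun j => hΦ j.1 j.2, fun θ hθ z => ?_⟩
  simp only [Set.mem_iInter, hmem _ θ hθ, Sigma.forall]

theorem inter {W W' : P → Set V} (hW : SOCDefinableOn D W) (hW' : SOCDefinableOn D W') :
    SOCDefinableOn D fun θ => W θ ∩ W' θ := by
  simp only [Set.inter_eq_iInter]
  exact iInter (W := fun b θ => cond b (W θ) (W' θ)) (Bool.forall_bool.2 ⟨hW', hW⟩)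

theorem preimage {W : P → Set V} (hW : SOCDefinableOn D W) (g : V' →ᵃ[ℝ] V) :
    SOCDefinableOn D fun θ => g ⁻¹' W θ := by
  obtain ⟨J, _, m, Φ, hΦ, hmem⟩ := hW
  exact ⟨J, inferInstance, m, fun θ j => (Φ θ j).comp g, fun j z => hΦ j (g z),
    fun θ hθ z => hmem θ hθ (g z)⟩

theorem setOf_eq_zero {κ : Type} [Finite κ] {f : P → V →ᵃ[ℝ] (κ → ℝ)}
    (hf : ∀ z, DifferentiableOn ℝ (fun θ => f θ z) D) :
    SOCDefinableOn D fun θ => {z | f θ z = 0} := by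
  have := Fintype.ofFinite κ
  let coord (k : κ) (θ : P) : V →ᵃ[ℝ] ℝ := (LinearMap.proj k).toAffineMap.comp (f θ)
  have hcoord (k : κ) (z : V) : DifferentiableOn ℝ (fun θ => coord k θ z) D :=
    differentiableOn_pi.1 (hf z) k
  convert iInter fun k => (setOf_nonneg (hcoord k)).inter
    (setOf_nonneg (f := fun θ => -coord k θ) fun z => (hcoord k z).neg) using 2
  ext z
  simp only [coord, Set.mem_ofPred_eq, Set.mem_iInter, Set.mem_inter_iff, funext_iff,
    le_antisymm_iff (b := (0 : ℝ)), Pi.zero_apply]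
  simp [and_comm]

end SOCDefinableOn

namespace SOCSystem

variable {P ι : Type}

theorem socDefinableOn_holds [Fintype ι] {P' : Type*} [NormedAddCommGroup P']
    [NormedSpace ℝ P'] (D : Set P') (S : SOCSystem P ι) (θ : P) :
    SOCDefinableOn D fun _ => {z : (ι → ℝ) × (S.N → ℝ) | S.Holds θ z.1 z.2} :=
  ⟨S.J, inferInstance, S.m, fun _ j => ((S.A θ j).mulVecLin ∘ₗ
    (LinearEquiv.sumArrowLequivProdArrow ι S.N ℝ ℝ).symm).toAffineMap -
      AffineMap.const ℝ _ (S.b θ j), fun _ _ => differentiableOn_const _, fun _ _ _ => Iff.rfl⟩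

theorem DataDifferentiableOn.socDefinableOn_isDualCertificate [Finite ι] [NormedAddCommGroup P]
    [NormedSpace ℝ P] {D : Set P} {S : SOCSystem P ι} (hS : S.DataDifferentiableOn D) :
    SOCDefinableOn D fun θ => {z : (∀ j, Fin (S.m j + 1) → ℝ) × (ι ⊕ S.N → ℝ) × ℝ |
      S.IsDualCertificate θ z.1 z.2.1 z.2.2} := by
  classical
  have := Fintype.ofFinite ι
  let coefficients (θ : P) :
      (∀ j, Fin (S.m j + 1) → ℝ) × (ι ⊕ S.N → ℝ) × ℝ →ₗ[ℝ] (ι ⊕ S.N → ℝ) :=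
    LinearMap.coprod (LinearMap.lsum ℝ _ ℝ fun j => (S.A θ j).vecMulLinear)
      (-LinearMap.fst ℝ _ _)
  let constant (θ : P) : (∀ j, Fin (S.m j + 1) → ℝ) × (ι ⊕ S.N → ℝ) × ℝ →ₗ[ℝ] ℝ :=
    LinearMap.coprod (LinearMap.lsum ℝ _ ℝ fun j => dotProductEquiv ℝ _ (S.b θ j))
      (LinearMap.snd ℝ _ _)
  have hcoefficients (θ : P) (z) : coefficients θ z =
      ∑ j, Matrix.vecMul (z.1 j) (S.A θ j) - z.2.1 := by
    simp [coefficients, sub_eq_add_neg]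
  have hconstant (θ : P) (z) : constant θ z = ∑ j, z.1 j ⬝ᵥ S.b θ j + z.2.2 := by
    simp [constant, dotProduct_comm]
  have conic := SOCDefinableOn.iInter fun j => SOCDefinableOn.secondOrderCone_preimage (D := D)
    (f := fun _ => (LinearMap.proj j ∘ₗ
      LinearMap.fst ℝ (∀ j, Fin (S.m j + 1) → ℝ) ((ι ⊕ S.N → ℝ) × ℝ)).toAffineMap)
    fun _ => differentiableOn_const _
  have stationary := SOCDefinableOn.setOf_eq_zero (D := D)
    (f := fun θ => (coefficients θ).toAffineMap) fun z => by
      simp only [LinearMap.coe_toAffineMap, hcoefficients]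
      refine DifferentiableOn.sub_const (DifferentiableOn.fun_sum fun j _ => ?_) _
      simp only [differentiableOn_pi, Matrix.vecMul, dotProduct]
      exact fun k => DifferentiableOn.fun_sum fun r _ => (hS.1 j r k).const_mul (z.1 j r)
  have bounded := SOCDefinableOn.setOf_nonneg (D := D)
    (f := fun θ => (constant θ).toAffineMap) fun z => by
      simp only [LinearMap.coe_toAffineMap, hconstant]
      refine DifferentiableOn.add_const _ (DifferentiableOn.fun_sum fun j _ => ?_)
      exact DifferentiableOn.fun_sum fun r _ => (hS.2 j r).const_mul (z.1 j r)
  convert conic.inter (stationary.inter bounded) using 2 with θ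
  ext z
  simp [IsDualCertificate, hcoefficients, hconstant, sub_eq_zero]

variable {N J : Type} [Fintype N] [Fintype J] {m : J → ℕ}
  {Φ : P → (j : J) → (ι ⊕ N → ℝ) →ᵃ[ℝ] (Fin (m j + 1) → ℝ)}

open Classical in
/-- The system whose `j`-th inequality says that the affine map `Φ θ j` takes its value in the
second-order cone; its data are the coordinates of the linear and constant parts of `Φ θ j`. -/
noncomputable abbrev ofAffine [Fintype ι] (m : J → ℕ)
    (Φ : P → (j : J) → (ι ⊕ N → ℝ) →ᵃ[ℝ] (Fin (m j + 1) → ℝ)) : SOCSystem P ι where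
  J := J
  N := N
  m := m
  A θ j := LinearMap.toMatrix' (Φ θ j).linear
  b θ j := -Φ θ j 0

variable [Fintype ι]

theorem ofAffine_holds_iff {θ : P} {y : ι → ℝ} {v : N → ℝ} :
    (ofAffine m Φ).Holds θ y v ↔ ∀ j, Φ θ j (Sum.elim y v) ∈ secondOrderCone (m j) := by
  simp [Holds, LinearMap.toMatrix'_mulVec, AffineMap.decomp']

theorem ofAffine_dataDifferentiableOn [NormedAddCommGroup P] [NormedSpace ℝ P] {D : Set P}
    (hΦ : ∀ j z, DifferentiableOn ℝ (fun θ => Φ θ j z) D) :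
    (ofAffine m Φ).DataDifferentiableOn D := by
  refine ⟨fun j r c => ?_, fun j => differentiableOn_pi.1 (hΦ j 0).neg⟩
  simp only [LinearMap.toMatrix'_apply, AffineMap.decomp', Pi.sub_apply]
  exact (differentiableOn_pi.1 (hΦ j _) r).sub (differentiableOn_pi.1 (hΦ j 0) r)

end SOCSystem

theorem dotProduct_linearEquiv_apply {k T N : Type*} [CommSemiring k] [AddCommMonoid T] [Module k T]
    [Fintype N] [DecidableEq N] (ℓ : T →ₗ[k] k) (e : T ≃ₗ[k] (N → k)) (t : T) :
    (fun a => ℓ (e.symm (Pi.single a 1))) ⬝ᵥ e t = ℓ t := by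
  have := (dotProductEquiv k N).apply_symm_apply (ℓ ∘ₗ e.symm.toLinearMap)
  exact (DFunLike.congr_fun this (e t)).trans (congrArg ℓ (e.symm_apply_apply t))

theorem SOCDefinableOn.exists_socSystem {P ι T : Type} [Fintype ι] [NormedAddCommGroup P]
    [NormedSpace ℝ P] [AddCommGroup T] [Module ℝ T] [FiniteDimensional ℝ T] {D : Set P}
    {W : P → Set ((ι → ℝ) × T)} (hW : SOCDefinableOn D W) :
    ∃ (S : SOCSystem P ι) (e : T ≃ₗ[ℝ] (S.N → ℝ)), S.DataDifferentiableOn D ∧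
      ∀ θ ∈ D, ∀ x t, S.Holds θ x (e t) ↔ (x, t) ∈ W θ := by
  let e := (Module.finBasis ℝ T).equivFun
  obtain ⟨J, _, m, Φ, hΦ, hmem⟩ := hW.preimage
    (((LinearEquiv.refl ℝ (ι → ℝ)).prodCongr e.symm).toLinearMap ∘ₗ
      (LinearEquiv.sumArrowLequivProdArrow ι _ ℝ ℝ).toLinearMap).toAffineMap
  refine ⟨SOCSystem.ofAffine m Φ, e, SOCSystem.ofAffine_dataDifferentiableOn hΦ,
    fun θ hθ x t => ?_⟩
  refine SOCSystem.ofAffine_holds_iff.trans ((hmem θ hθ _).symm.trans ?_)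
  change (x, e.symm (e t)) ∈ W θ ↔ _
  rw [e.symm_apply_apply]

/-- A reformulation of the domination of the cost `c x` on the support by a function `h`: for some
auxiliary variable `t` with `(x, t) ∈ constraints`, finitely many functions that are affine both in
`y` and in `(x, t)` are dominated by `h`. This is all that the duality argument uses about the
cost. -/
structure MajorantRepresentation {n K : ℕ} {P : Type} [NormedAddCommGroup P] [NormedSpace ℝ P]
    (D : Set P) (X : Set (Fin n → ℝ)) (supp : Set (Fin K → ℝ))
    (c : (Fin n → ℝ) → (Fin K → ℝ) → ℝ) where
  T : Type
  [addCommGroup : AddCommGroup T]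
  [module : Module ℝ T]
  [finiteDimensional : FiniteDimensional ℝ T]
  L : Type
  [fintype : Fintype L]
  constraints : Set ((Fin n → ℝ) × T)
  const : L → (Fin n → ℝ) × T →ᵃ[ℝ] ℝ
  slope : L → (Fin n → ℝ) × T →ᵃ[ℝ] (Fin K → ℝ)
  socDefinableOn_constraints : SOCDefinableOn D fun _ => constraints
  forall_cost_le_iff : ∀ x ∈ X, ∀ h : (Fin K → ℝ) → ℝ, (∀ y ∈ supp, c x y ≤ h y) ↔
    ∃ t : T, (x, t) ∈ constraints ∧ ∀ l, ∀ y ∈ supp, const l (x, t) + slope l (x, t) ⬝ᵥ y ≤ h y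

attribute [instance] MajorantRepresentation.addCommGroup MajorantRepresentation.module
  MajorantRepresentation.finiteDimensional MajorantRepresentation.fintype

section Cost

variable {n K : ℕ} {P : Type} [NormedAddCommGroup P] [NormedSpace ℝ P] (D : Set P)
  {X : Set (Fin n → ℝ)} {supp : Set (Fin K → ℝ)} {c : (Fin n → ℝ) → (Fin K → ℝ) → ℝ}

theorem IsSingleStageCost.nonempty_majorantRepresentation (hc : IsSingleStageCost supp c) :
    Nonempty (MajorantRepresentation D X supp c) := by
  obtain ⟨⟨ck, hck, hsum⟩, hpos⟩ := hc
  choose S hS using hck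
  have epigraph_iff (k x s) : ck k x ≤ s ↔ ∃ v, (S k).Holds () (Sum.elim x fun _ => s) v := by
    rw [← hS k]
    simp [epigraph]
  let point (k : Fin K) : (Fin n → ℝ) × (Fin K → ℝ) × (∀ k, (S k).N → ℝ) →ₗ[ℝ]
      (Fin n ⊕ Unit → ℝ) × ((S k).N → ℝ) :=
    { toFun := fun z => (Sum.elim z.1 fun _ => z.2.1 k, z.2.2 k)
      map_add' := fun z w => by ext i <;> first | rfl | rcases i with i | i <;> rfl
      map_smul' := fun r z => by ext i <;> first | rfl | rcases i with i | i <;> rfl }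
  refine ⟨{
    T := (Fin K → ℝ) × (∀ k, (S k).N → ℝ)
    L := Unit
    constraints := {z | ∀ k, (S k).Holds () (Sum.elim z.1 fun _ => z.2.1 k) (z.2.2 k)}
    const := 0
    slope := fun _ => (LinearMap.fst ℝ _ _ ∘ₗ LinearMap.snd ℝ _ _).toAffineMap
    socDefinableOn_constraints := ?_
    forall_cost_le_iff := fun x _ h => ⟨fun hle => ?_, fun hle y hy => ?_⟩ }⟩
  · convert SOCDefinableOn.iInter fun k => ((S k).socDefinableOn_holds D ()).preimage
      (point k).toAffineMap using 2
    ext z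
    simp [point]
  · choose v hv using fun k => (epigraph_iff k x (ck k x)).1 le_rfl
    refine ⟨(fun k => ck k x, v), hv, fun _ y hy => ?_⟩
    simpa [hsum, dotProduct] using hle y hy
  · obtain ⟨t, ht, hle⟩ := hle
    calc c x y = ∑ k, ck k x * y k := hsum x y
      _ ≤ ∑ k, t.1 k * y k := Finset.sum_le_sum fun k _ =>
        mul_le_mul_of_nonneg_right ((epigraph_iff k x _).2 ⟨_, ht k⟩) (hpos y hy k)
      _ ≤ h y := by simpa [dotProduct] using hle () y hy

/-- The right-hand side of the recourse problem, once `(T₀ + ∑ k, y_k T_k) x` is moved there. -/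
def recourseRhs {M : ℕ} (T₀ : Matrix (Fin M) (Fin n) ℝ) (T : Fin K → Matrix (Fin M) (Fin n) ℝ)
    (h₀ : Fin M → ℝ) (h : Fin K → Fin M → ℝ) (x : Fin n → ℝ) (y : Fin K → ℝ) : Fin M → ℝ :=
  h₀ + ∑ k, y k • h k - (T₀ + ∑ k, y k • T k).mulVec x

variable {M G : ℕ} {T₀ : Matrix (Fin M) (Fin n) ℝ} {T : Fin K → Matrix (Fin M) (Fin n) ℝ}
  {h₀ : Fin M → ℝ} {h : Fin K → Fin M → ℝ}

theorem recourseFeasible_eq_standardFeasible (W : Matrix (Fin M) (Fin G) ℝ) (x : Fin n → ℝ)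
    (y : Fin K → ℝ) : recourseFeasible T₀ T h₀ h W x y =
      standardFeasible W (recourseRhs T₀ T h₀ h x y) := by
  ext γ
  exact and_congr Iff.rfl eq_sub_iff_add_eq'.symm

theorem dotProduct_recourseRhs (π : Fin M → ℝ) (x : Fin n → ℝ) (y : Fin K → ℝ) :
    π ⬝ᵥ recourseRhs T₀ T h₀ h x y =
      π ⬝ᵥ (h₀ - T₀.mulVec x) + (fun k => π ⬝ᵥ (h k - (T k).mulVec x)) ⬝ᵥ y := by
  have hsum (v : Fin K → ℝ) : v ⬝ᵥ y = ∑ k, y k * v k := by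
    rw [dotProduct_comm, dotProduct]
  rw [recourseRhs, Matrix.add_mulVec, Matrix.sum_mulVec, hsum]
  simp only [dotProduct_sub, dotProduct_add, dotProduct_sum, dotProduct_smul, Matrix.smul_mulVec,
    smul_eq_mul, mul_sub, Finset.sum_sub_distrib]
  ring

theorem IsTwoStageCost.nonempty_majorantRepresentation (hc : IsTwoStageCost X supp c) :
    Nonempty (MajorantRepresentation D X supp c) := by
  obtain ⟨M, G, T₀, T, h₀, h, W, q, hc⟩ := hc
  obtain ⟨s, hs⟩ := exists_finset_isGreatest_dual W q
  have dual_cost {x y} (hx : x ∈ X) (hy : y ∈ supp) :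
      IsGreatest ((· ⬝ᵥ recourseRhs T₀ T h₀ h x y) '' (s : Set (Fin M → ℝ))) (c x y) :=
    hs _ _ (recourseFeasible_eq_standardFeasible (T₀ := T₀) W x y ▸ (hc x hx y hy).2)
  let residual (b : Fin M → ℝ) (B : Matrix (Fin M) (Fin n) ℝ) (π : Fin M → ℝ) :
      (Fin n → ℝ) × (Fin 0 → ℝ) →ᵃ[ℝ] ℝ :=
    (dotProductEquiv ℝ _ π).toAffineMap.comp
      (AffineMap.const ℝ _ b - (B.mulVecLin ∘ₗ LinearMap.fst ℝ _ _).toAffineMap)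
  refine ⟨{
    T := Fin 0 → ℝ
    L := s
    constraints := ⋂ l : Empty, l.elim
    const := fun π => residual h₀ T₀ π
    slope := fun π => AffineMap.pi fun k => residual (h k) (T k) π
    socDefinableOn_constraints := SOCDefinableOn.iInter (W := fun l _ => l.elim) (Empty.rec _)
    forall_cost_le_iff := fun x hx f => ?_ }⟩
  have value (π : Fin M → ℝ) (t y) : residual h₀ T₀ π (x, t) +
      (fun k => residual (h k) (T k) π (x, t)) ⬝ᵥ y = π ⬝ᵥ recourseRhs T₀ T h₀ h x y :=
    (dotProduct_recourseRhs π x y).symm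
  have cost_le_iff (y) (hy : y ∈ supp) :
      c x y ≤ f y ↔ ∀ π : s, (π : Fin M → ℝ) ⬝ᵥ recourseRhs T₀ T h₀ h x y ≤ f y := by
    rw [isLUB_le_iff (dual_cost hx hy).isLUB, mem_upperBounds]
    simp
  refine ⟨fun hle => ⟨0, by simp, fun π y hy => ?_⟩, fun ⟨t, _, hle⟩ y hy => ?_⟩
  · exact (value π 0 y).trans_le ((cost_le_iff y hy).1 (hle y hy) π)
  · exact (cost_le_iff y hy).2 fun π => (value π t y).ge.trans (hle π y hy)

end Cost

namespace ParamSOCAmbiguity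

variable {K I : ℕ} {U : ParamSOCAmbiguity K I} {R : SOCSystem U.Param (Fin K ⊕ Fin I)}
  {θ : U.Param}

theorem Slater.exists_mem_supp_forall_lt (slater : U.Slater R θ)
    (hR : R.Represents U.paramDom U.lifted) (hθ : θ ∈ U.paramDom) :
    ∃ y ∈ U.supp, ∀ i, U.g i y (θ.1 i) < θ.2 i := by
  obtain ⟨y, u, v, hu, hv⟩ := slater
  obtain ⟨hy, hg⟩ := (hR.2 θ hθ (Sum.elim y u)).2
    ⟨v, fun j => secondOrderConeStrict_subset _ (hv j)⟩
  exact ⟨y, hy, fun i => (hg i).trans_lt (hu i)⟩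

theorem forall_mem_supp_nonneg_iff_lifted {d : Fin K → ℝ} {β : Fin I → ℝ} (hβ : 0 ≤ β) (a : ℝ) :
    (∀ y ∈ U.supp, 0 ≤ d ⬝ᵥ y + ∑ i, β i * U.g i y (θ.1 i) + a) ↔
      ∀ z ∈ U.lifted θ, 0 ≤ Sum.elim d β ⬝ᵥ z + a := by
  refine ⟨fun h z ⟨hy, hg⟩ => (h _ hy).trans ?_, fun h y hy => ?_⟩
  · simp only [dotProduct, Fintype.sum_sum_type, Sum.elim_inl, Sum.elim_inr]
    gcongr with i
    exacts [hβ i, hg i]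
  · simpa [dotProduct] using h (Sum.elim y fun i => U.g i y (θ.1 i)) ⟨hy, fun _ => le_rfl⟩

end ParamSOCAmbiguity

namespace MajorantRepresentation

variable {n K I : ℕ} {X : Set (Fin n → ℝ)} {U : ParamSOCAmbiguity K I}
  {c : (Fin n → ℝ) → (Fin K → ℝ) → ℝ} (C : MajorantRepresentation U.paramDom X U.supp c)
  (R : SOCSystem U.Param (Fin K ⊕ Fin I))

/-- The variables `(r, β, λ, t)` of the dual program: the multipliers of the total mass and of the
moment constraints, one conic multiplier vector for each affine function of `C`, and the auxiliary
variables of `C`. -/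
abbrev DualVariable : Type :=
  ℝ × (Fin I → ℝ) × (C.L → ∀ j, Fin (R.m j + 1) → ℝ) × C.T

/-- The feasible set of the dual program. The certificates are those of the nonnegativity on the
lifted support of `r + β ⬝ᵥ u - (const l (x, t) + slope l (x, t) ⬝ᵥ y)`, whose coefficients at the
auxiliary variables of `R` vanish. -/
def dualFeasible (θ : U.Param) : Set ((Fin n → ℝ) × C.DualVariable R) :=
  {(x, r, β, lam, t) | (x, t) ∈ C.constraints ∧ 0 ≤ β ∧ ∀ l, R.IsDualCertificate θ (lam l)
    (Sum.elim (Sum.elim (-C.slope l (x, t)) β) 0) (r - C.const l (x, t))}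

/-- The objective `r + σ ⬝ᵥ β` of the dual program. -/
noncomputable def dualObjective (θ : U.Param) : C.DualVariable R →ₗ[ℝ] ℝ :=
  LinearMap.coprod LinearMap.id (dotProductEquiv ℝ (Fin I) θ.2 ∘ₗ LinearMap.fst ℝ _ _)

variable {C R}

theorem differentiableOn_dualObjective (w : C.DualVariable R) (D : Set U.Param) :
    DifferentiableOn ℝ (fun θ => C.dualObjective R θ w) D := by
  change DifferentiableOn ℝ (fun θ : U.Param => w.1 + ∑ i, θ.2 i * w.2.1 i) D
  fun_prop

theorem socDefinableOn_dualFeasible (hR : R.DataDifferentiableOn U.paramDom) :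
    SOCDefinableOn U.paramDom (C.dualFeasible R) := by
  let mass : (Fin n → ℝ) × C.DualVariable R →ₗ[ℝ] ℝ := LinearMap.fst ℝ _ _ ∘ₗ LinearMap.snd ℝ _ _
  let moment : (Fin n → ℝ) × C.DualVariable R →ₗ[ℝ] (Fin I → ℝ) :=
    LinearMap.fst ℝ _ _ ∘ₗ LinearMap.snd ℝ _ _ ∘ₗ LinearMap.snd ℝ _ _
  let tail : (Fin n → ℝ) × C.DualVariable R →ₗ[ℝ] (C.L → ∀ j, Fin (R.m j + 1) → ℝ) × C.T :=
    LinearMap.snd ℝ _ _ ∘ₗ LinearMap.snd ℝ _ _ ∘ₗ LinearMap.snd ℝ _ _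
  let cost : (Fin n → ℝ) × C.DualVariable R →ᵃ[ℝ] (Fin n → ℝ) × C.T :=
    ((LinearMap.fst ℝ _ _).prod (LinearMap.snd ℝ _ _ ∘ₗ tail)).toAffineMap
  let embed : (Fin K → ℝ) × (Fin I → ℝ) →ₗ[ℝ] ((Fin K ⊕ Fin I) ⊕ R.N → ℝ) :=
    (LinearEquiv.sumArrowLequivProdArrow _ _ ℝ ℝ).symm.toLinearMap ∘ₗ LinearMap.inl ℝ _ _ ∘ₗ
      (LinearEquiv.sumArrowLequivProdArrow _ _ ℝ ℝ).symm.toLinearMap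
  let certificate (l : C.L) : (Fin n → ℝ) × C.DualVariable R →ᵃ[ℝ]
      (∀ j, Fin (R.m j + 1) → ℝ) × ((Fin K ⊕ Fin I) ⊕ R.N → ℝ) × ℝ :=
    (LinearMap.proj l ∘ₗ LinearMap.fst ℝ _ _ ∘ₗ tail).toAffineMap.prod
      ((embed.toAffineMap.comp ((-(C.slope l).comp cost).prod moment.toAffineMap)).prod
        (mass.toAffineMap - (C.const l).comp cost))
  have nonneg := SOCDefinableOn.iInter fun i => SOCDefinableOn.setOf_nonneg (D := U.paramDom)
    (f := fun _ => (LinearMap.proj i ∘ₗ moment).toAffineMap) fun _ => differentiableOn_const _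
  have certified := SOCDefinableOn.iInter fun l =>
    hR.socDefinableOn_isDualCertificate.preimage (certificate l)
  convert (C.socDefinableOn_constraints.preimage cost).inter (nonneg.inter certified) using 2
    with θ
  ext z
  simp only [Set.mem_inter_iff, Set.mem_iInter]
  exact Iff.rfl

theorem forall_cost_le_iff_exists_mem_dualFeasible (hR : R.Represents U.paramDom U.lifted)
    {θ : U.Param} (hθ : θ ∈ U.paramDom) (slater : U.Slater R θ) {x : Fin n → ℝ} (hx : x ∈ X)
    {r : ℝ} {β : Fin I → ℝ} (hβ : 0 ≤ β) :
    (∀ y ∈ U.supp, c x y ≤ r + ∑ i, β i * U.g i y (θ.1 i)) ↔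
      ∃ lam t, (x, r, β, lam, t) ∈ C.dualFeasible R θ := by
  obtain ⟨y₀, u₀, v₀, -, strict⟩ := slater
  have certificate_iff (a : ℝ) (d : Fin K → ℝ) :
      (∀ y ∈ U.supp, a + d ⬝ᵥ y ≤ r + ∑ i, β i * U.g i y (θ.1 i)) ↔
        ∃ lam, R.IsDualCertificate θ lam (Sum.elim (Sum.elim (-d) β) 0) (r - a) := by
    rw [← hR.forall_mem_nonneg_iff hθ strict,
      ← ParamSOCAmbiguity.forall_mem_supp_nonneg_iff_lifted hβ]
    refine forall₂_congr fun y _ => ?_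
    rw [neg_dotProduct, ← sub_nonneg]
    exact iff_of_eq (congrArg (0 ≤ ·) (by ring))
  rw [C.forall_cost_le_iff x hx]
  simp only [certificate_iff, Classical.skolem]
  exact ⟨fun ⟨t, ht, lam, hlam⟩ => ⟨lam, t, ht, hβ, hlam⟩,
    fun ⟨lam, t, ht, _, hlam⟩ => ⟨t, ht, lam, hlam⟩⟩

theorem worstCaseExpectation_le_coe_iff (C : MajorantRepresentation U.paramDom X U.supp c)
    (hR : R.Represents U.paramDom U.lifted) {θ : U.Param} (hθ : θ ∈ U.paramDom)
    (slater : U.Slater R θ) {x : Fin n → ℝ} (hx : x ∈ X) (F : ℝ) :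
    worstCaseExpectation U c θ x ≤ (F : EReal) ↔
      ∃ w, (x, w) ∈ C.dualFeasible R θ ∧ C.dualObjective R θ w ≤ F := by
  obtain ⟨y₀, hy₀, hlt⟩ := slater.exists_mem_supp_forall_lt hR hθ
  have objective_eq (r : ℝ) (β : Fin I → ℝ) (lam t) :
      C.dualObjective R θ (r, β, lam, t) = r + ∑ i, β i * θ.2 i :=
    congrArg (r + ·) (dotProduct_comm θ.2 β)
  rw [ParamSOCAmbiguity.worstCaseExpectation_le_coe_iff hy₀ hlt]
  constructor
  · rintro ⟨r, β, hβ, hle, hF⟩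
    obtain ⟨lam, t, hw⟩ :=
      (forall_cost_le_iff_exists_mem_dualFeasible (C := C) hR hθ slater hx hβ).1 hle
    exact ⟨(r, β, lam, t), hw, (objective_eq r β lam t).trans_le hF⟩
  · rintro ⟨⟨r, β, lam, t⟩, hw, hF⟩
    have hβ : 0 ≤ β := hw.2.1
    have hle := (forall_cost_le_iff_exists_mem_dualFeasible hR hθ slater hx hβ).2 ⟨lam, t, hw⟩
    exact ⟨r, β, hβ, hle, (objective_eq r β lam t).ge.trans hF⟩

end MajorantRepresentation

theorem mainTheorem2 {n K I : ℕ} (X : Set (Fin n → ℝ)) (U : ParamSOCAmbiguity K I)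
    (c : (Fin n → ℝ) → (Fin K → ℝ) → ℝ)
    (hc : IsSingleStageCost U.supp c ∨ IsTwoStageCost X U.supp c)
    (R : SOCSystem U.Param (Fin K ⊕ Fin I)) (hR : R.Represents U.paramDom U.lifted) :
    ∃ (S : SOCSystem U.Param (Fin n)) (q : U.Param → S.N → ℝ),
      S.DataDifferentiableOn U.paramDom ∧
      (∀ a, DifferentiableOn ℝ (fun θ => q θ a) U.paramDom) ∧
      ∀ θ ∈ U.paramDom, U.Slater R θ → ∀ x ∈ X,
        worstCaseExpectation U c θ x = S.programValue q θ x ∧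
        (worstCaseExpectation U c θ x ≠ ⊤ →
          ∃ w, S.Holds θ x w ∧ ((q θ ⬝ᵥ w : ℝ) : EReal) = worstCaseExpectation U c θ x) := by
  classical
  obtain ⟨C⟩ : Nonempty (MajorantRepresentation U.paramDom X U.supp c) :=
    hc.elim (·.nonempty_majorantRepresentation _) (·.nonempty_majorantRepresentation _)
  obtain ⟨S, e, hS, holds_iff⟩ := (C.socDefinableOn_dualFeasible hR.1).exists_socSystem
  refine ⟨S, fun θ a => C.dualObjective R θ (e.symm (Pi.single a 1)), hS,
    fun a => MajorantRepresentation.differentiableOn_dualObjective _ _,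
    fun θ hθ slater x hx => ?_⟩
  obtain ⟨y₀, hy₀, hlt⟩ := slater.exists_mem_supp_forall_lt hR hθ
  refine ereal_eq_iInf_and_exists_eq (ne_bot_of_le_ne_bot (EReal.coe_ne_bot _)
    (ParamSOCAmbiguity.coe_le_worstCaseExpectation hy₀ fun i => (hlt i).le)) fun F => ?_
  rw [C.worstCaseExpectation_le_coe_iff hR hθ slater hx, e.surjective.exists]
  simp only [holds_iff θ hθ, dotProduct_linearEquiv_apply]
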